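/- Let $M$ be a compact $n$-dimensional smooth manifold without boundary, equipped with a smooth positive density $\mathrm{vol}$, let $E\to M$ and $F\to M$ be smooth real vector bundles of finite rank, and let $L\colon C^\infty(M,E)\to C^\infty(M,F)$ be a linear differential operator of order at most $k\in\mathbb{N}_0$ with smooth coefficients. For $\Omega\subseteq M$ open, let $\mathcal{D}(\Omega,\cdot)$ denote the smooth sections with compact support in $\Omega$, and let $\mathcal{D}'(\Omega,E)$ be the space of distributional sections of $E$ over $\Omega$, i.e. of continuous linear functionals on $\mathcal{D}(\Omega,E^*)$. Let $L^*\colon C^\infty(M,F^*)\to C^\infty(M,E^*)$ be the formally dual operator, characterized by $\int_M\langle Lu,\varphi\rangle\,\mathrm{vol}=\int_M\langle u,L^*\varphi\rangle\,\mathrm{vol}$ for all $u\in C^\infty(M,E)$ and $\varphi\in C^\infty(M,F^*)$ such that $\operatorname{supp}u\cap\operatorname{supp}\varphi$ is compact, and extend $L$ to $\mathcal{D}'(\Omega,E)\to\mathcal{D}'(\Omega,F)$ by $(Lu)[\varphi]:=u[L^*\varphi]$. Suppose that $L$ is weakly hypoelliptic: for every open $\Omega\subseteq M$, every $u\in\mathcal{D}'(\Omega,E)$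 with $Lu=0$ is smooth, i.e. given by $u[\varphi]=\int_\Omega\langle s,\varphi\rangle\,\mathrm{vol}$ for a smooth section $s$ of $E$ over $\Omega$. Then the solution space $\mathcal{H}(M,L)=\{u\in\mathcal{D}'(M,E): Lu=0\}$ is a finite-dimensional real vector space. -/

import Mathlib

open Set Filter Topology MeasureTheory Bundle
open scoped Manifold ContDiff

noncomputable section

namespace WeakHypo

section Density

/-- A measure `μ` on an `n`-dimensional manifold is given by a smooth positive density: in every
chart of the atlas it has a smooth positive density with respect to Lebesgue measure. -/
def IsSmoothPositiveDensity {n : ℕ} {M : Type*} [TopologicalSpace M]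
    [ChartedSpace (EuclideanSpace ℝ (Fin n)) M] [MeasurableSpace M] (μ : Measure M) : Prop :=
  ∀ e ∈ atlas (EuclideanSpace ℝ (Fin n)) M, ∃ ρ : EuclideanSpace ℝ (Fin n) → ℝ,
    ContDiffOn ℝ ∞ ρ e.target ∧ (∀ y ∈ e.target, 0 < ρ y) ∧
      (μ.restrict e.source).map e =
        (volume.restrict e.target).withDensity (fun y => ENNReal.ofReal (ρ y))

end Density

section Sections

variable {n : ℕ} {M : Type*} [TopologicalSpace M] [ChartedSpace (EuclideanSpace ℝ (Fin n)) M]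
  (V : Type*) [NormedAddCommGroup V] [NormedSpace ℝ V]
  (E : M → Type*) [∀ x, AddCommGroup (E x)] [∀ x, Module ℝ (E x)] [∀ x, TopologicalSpace (E x)]
  [TopologicalSpace (TotalSpace V E)] [FiberBundle V E] [VectorBundle ℝ V E]

/-- The space `C^∞(M, E)` of smooth sections of the vector bundle `E` with model fibre `V`. -/
abbrev SmoothSection : Type _ := ContMDiffSection (𝓡 n) V ∞ E

/-- The fibre at `x` of the dual bundle `E*` (a smooth vector bundle with model fibre
`V →L[ℝ] ℝ`). -/
abbrev DualBundle (x : M) : Type _ := E x →L[ℝ] ℝ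

end Sections

section Support

variable {M : Type*} [TopologicalSpace M] {E : M → Type*} [∀ x, AddCommGroup (E x)]

/-- The support of a section. -/
def sectionSupport (s : Π x, E x) : Set M := closure {x | s x ≠ 0}

end Support

section LocalRep

variable {n : ℕ} {M : Type*} [TopologicalSpace M] [ChartedSpace (EuclideanSpace ℝ (Fin n)) M]
  (V : Type*) [NormedAddCommGroup V] [NormedSpace ℝ V]
  {E : M → Type*} [∀ x, AddCommGroup (E x)] [∀ x, Module ℝ (E x)] [∀ x, TopologicalSpace (E x)]
  [TopologicalSpace (TotalSpace V E)] [FiberBundle V E] [VectorBundle ℝ V E]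

/-- The section `s`, read in the chart of `M` and the trivialization of `E` around `p`, as a
`V`-valued function on `ℝⁿ`. It is meaningful on the image, under the chart, of the common domain of
the chart and the trivialization. -/
def localRep (p : M) (s : Π x, E x) (y : EuclideanSpace ℝ (Fin n)) : V :=
  (trivializationAt V E p
    (TotalSpace.mk' V ((chartAt (EuclideanSpace ℝ (Fin n)) p).symm y)
      (s ((chartAt (EuclideanSpace ℝ (Fin n)) p).symm y)))).2

variable (n E) in
/-- The common domain of the chart of `M` and the trivialization of `E` around `p`. -/
def localDomain (p : M) : Set M :=
  (chartAt (EuclideanSpace ℝ (Fin n)) p).source ∩ (trivializationAt V E p).baseSet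

end LocalRep

section Operators

variable {n : ℕ} {M : Type*} [TopologicalSpace M] [ChartedSpace (EuclideanSpace ℝ (Fin n)) M]
  {V : Type*} [NormedAddCommGroup V] [NormedSpace ℝ V]
  {E : M → Type*} [∀ x, AddCommGroup (E x)] [∀ x, Module ℝ (E x)] [∀ x, TopologicalSpace (E x)]
  [TopologicalSpace (TotalSpace V E)] [FiberBundle V E] [VectorBundle ℝ V E]
  {W : Type*} [NormedAddCommGroup W] [NormedSpace ℝ W]
  {F : M → Type*} [∀ x, AddCommGroup (F x)] [∀ x, Module ℝ (F x)] [∀ x, TopologicalSpace (F x)]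
  [TopologicalSpace (TotalSpace W F)] [FiberBundle W F] [VectorBundle ℝ W F]

/-- `L : C^∞(M, E) → C^∞(M, F)` is a linear differential operator of order (at most) `k` with smooth
coefficients: in local coordinates and local trivializations,
`(L u)(y) = ∑_{i ≤ k} a_i(y) (D^i u(y))`, where `a_i(y)` is a linear map from the `i`-linear maps
`(ℝⁿ)^i → V` to `W`, depending smoothly on `y`. (Evaluating `D^i u(y)` on the standard basis, this is
the usual expression with matrix-valued coefficients in front of the partial derivatives of `u`.) -/
def IsDifferentialOperator (k : ℕ)
    (L : SmoothSection (n := n) V E →ₗ[ℝ] SmoothSection (n := n) W F) : Prop :=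
  ∀ p : M, ∃ a : (i : ℕ) → EuclideanSpace ℝ (Fin n) →
      ((EuclideanSpace ℝ (Fin n)) [×i]→L[ℝ] V) →L[ℝ] W,
    (∀ i ≤ k, ContDiffOn ℝ ∞ (a i)
      (chartAt (EuclideanSpace ℝ (Fin n)) p '' (localDomain n V E p ∩ localDomain n W F p))) ∧
    ∀ u : SmoothSection (n := n) V E,
      ∀ y ∈ chartAt (EuclideanSpace ℝ (Fin n)) p '' (localDomain n V E p ∩ localDomain n W F p),
        localRep W p (L u) y =
          ∑ i ∈ Finset.range (k + 1), a i y (iteratedFDeriv ℝ i (localRep V p u) y)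

end Operators

section TestSections

variable {n : ℕ} {M : Type*} [TopologicalSpace M] [ChartedSpace (EuclideanSpace ℝ (Fin n)) M]
  (V : Type*) [NormedAddCommGroup V] [NormedSpace ℝ V]
  (E : M → Type*) [∀ x, AddCommGroup (E x)] [∀ x, Module ℝ (E x)] [∀ x, TopologicalSpace (E x)]
  [TopologicalSpace (TotalSpace V E)] [FiberBundle V E] [VectorBundle ℝ V E]

variable (n) in
/-- The space `𝓓(Ω, E)` of smooth sections of `E` with compact support contained in the open set
`Ω` (extended by zero to `M`). -/
def testSections (Ω : TopologicalSpace.Opens M) : Submodule ℝ (SmoothSection (n := n) V E) where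
  carrier := {φ | IsCompact (sectionSupport φ) ∧ sectionSupport φ ⊆ Ω}
  zero_mem' := by simp [sectionSupport]
  add_mem' := by
    intro φ ψ hφ hψ
    have h : sectionSupport (φ + ψ : SmoothSection (n := n) V E) ⊆
        sectionSupport φ ∪ sectionSupport ψ := by
      unfold sectionSupport
      rw [← closure_union]
      refine closure_mono fun x hx => ?_
      by_contra hc
      simp only [mem_union, mem_ofPred_eq, not_or, not_not] at hc
      exact hx (by simp [hc.1, hc.2])
    exact ⟨(hφ.1.union hψ.1).of_isClosed_subset isClosed_closure h,
      h.trans (union_subset hφ.2 hψ.2)⟩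
  smul_mem' := by
    intro c φ hφ
    have h : sectionSupport (c • φ : SmoothSection (n := n) V E) ⊆ sectionSupport φ := by
      refine closure_mono fun x hx hc => hx ?_
      simp [hc]
    exact ⟨hφ.1.of_isClosed_subset isClosed_closure h, h.trans hφ.2⟩

variable {V E}

/-- Convergence `φ_j → 0` in `𝓓(Ω, E)`: the supports lie in a common compact subset of `Ω`, and all
derivatives of `φ_j` in local coordinates and trivializations converge to zero, uniformly on compact
sets. -/
def TendstoZeroTest {Ω : TopologicalSpace.Opens M} (φ : ℕ → testSections n V E Ω) : Prop :=
  (∃ K : Set M, IsCompact K ∧ K ⊆ Ω ∧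
      ∀ j, sectionSupport (φ j : SmoothSection (n := n) V E) ⊆ K) ∧
    ∀ (p : M) (K : Set M), IsCompact K → K ⊆ localDomain n V E p → ∀ i : ℕ,
      TendstoUniformlyOn
        (fun j x => iteratedFDeriv ℝ i (localRep V p (φ j : SmoothSection (n := n) V E))
          (chartAt (EuclideanSpace ℝ (Fin n)) p x))
        (fun _ => 0) atTop K

end TestSections

section Distributions

variable {n : ℕ} {M : Type*} [TopologicalSpace M] [ChartedSpace (EuclideanSpace ℝ (Fin n)) M]
  (V : Type*) [NormedAddCommGroup V] [NormedSpace ℝ V]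
  (E : M → Type*) [∀ x, AddCommGroup (E x)] [∀ x, Module ℝ (E x)] [∀ x, TopologicalSpace (E x)]
  [TopologicalSpace (TotalSpace V E)] [FiberBundle V E] [VectorBundle ℝ V E]

variable (n) in
/-- The space `𝓓'(Ω, E)` of distributional sections of `E` over `Ω`: the linear functionals on
`𝓓(Ω, E*)` that are (sequentially) continuous. -/
def distributions (Ω : TopologicalSpace.Opens M) :
    Submodule ℝ (Module.Dual ℝ (testSections n (V →L[ℝ] ℝ) (DualBundle E) Ω)) where
  carrier := {u | ∀ φ : ℕ → testSections n (V →L[ℝ] ℝ) (DualBundle E) Ω,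
    TendstoZeroTest φ → Tendsto (fun j => u (φ j)) atTop (𝓝 0)}
  zero_mem' := fun φ _ => by simp
  add_mem' := fun hu hv φ hφ => by simpa using (hu φ hφ).add (hv φ hφ)
  smul_mem' := fun c u hu φ hφ => by simpa using (hu φ hφ).const_mul c

variable {V E}

/-- A distributional section `u` over `Ω` is smooth: there is a smooth section `s` of `E` over `Ω`
with `u[φ] = ∫_Ω ⟨s, φ⟩ vol` for all `φ ∈ 𝓓(Ω, E*)`. -/
def IsSmoothDistribution [MeasurableSpace M] (μ : Measure M) {Ω : TopologicalSpace.Opens M}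
    (u : Module.Dual ℝ (testSections n (V →L[ℝ] ℝ) (DualBundle E) Ω)) : Prop :=
  ∃ s : Π x, E x,
    ContMDiffOn (𝓡 n) ((𝓡 n).prod 𝓘(ℝ, V)) ∞ (fun x => TotalSpace.mk' V x (s x)) Ω ∧
      ∀ φ : testSections n (V →L[ℝ] ℝ) (DualBundle E) Ω,
        u φ = ∫ x in (Ω : Set M),
          (φ : SmoothSection (n := n) (V →L[ℝ] ℝ) (DualBundle E)) x (s x) ∂μ

end Distributions

section WeakSolutions

variable {n : ℕ} {M : Type*} [TopologicalSpace M] [ChartedSpace (EuclideanSpace ℝ (Fin n)) M]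
  [MeasurableSpace M] (μ : Measure M)
  {V : Type*} [NormedAddCommGroup V] [NormedSpace ℝ V]
  {E : M → Type*} [∀ x, AddCommGroup (E x)] [∀ x, Module ℝ (E x)] [∀ x, TopologicalSpace (E x)]
  [TopologicalSpace (TotalSpace V E)] [FiberBundle V E] [VectorBundle ℝ V E]
  {W : Type*} [NormedAddCommGroup W] [NormedSpace ℝ W]
  {F : M → Type*} [∀ x, AddCommGroup (F x)] [∀ x, Module ℝ (F x)] [∀ x, TopologicalSpace (F x)]
  [TopologicalSpace (TotalSpace W F)] [FiberBundle W F] [VectorBundle ℝ W F]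

/-- `ψ = L* φ`, where `L*` is the formally dual operator of `L` with respect to `μ`: this is
characterized by `∫ ⟨L u, φ⟩ vol = ∫ ⟨u, ψ⟩ vol` for all smooth sections `u` such that
`supp u ∩ supp φ` is compact. For a differential operator `L` and a smooth positive density `μ`,
such a `ψ` exists (integration by parts) and is unique (fundamental lemma of the calculus of
variations), so that this is the graph of the operator `L*`. -/
def IsFormalDual (L : SmoothSection (n := n) V E →ₗ[ℝ] SmoothSection (n := n) W F)
    (φ : SmoothSection (n := n) (W →L[ℝ] ℝ) (DualBundle F))
    (ψ : SmoothSection (n := n) (V →L[ℝ] ℝ) (DualBundle E)) : Prop :=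
  ∀ u : SmoothSection (n := n) V E, IsCompact (sectionSupport u ∩ sectionSupport φ) →
    ∫ x, φ x (L u x) ∂μ = ∫ x, ψ x (u x) ∂μ

/-- The space of distributional sections `u ∈ 𝓓'(Ω, E)` with `L u = 0`, that is, with
`u[L* φ] = 0` for all `φ ∈ 𝓓(Ω, F*)`. -/
def solutionSpace (L : SmoothSection (n := n) V E →ₗ[ℝ] SmoothSection (n := n) W F)
    (Ω : TopologicalSpace.Opens M) :
    Submodule ℝ (Module.Dual ℝ (testSections n (V →L[ℝ] ℝ) (DualBundle E) Ω)) where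
  carrier := {u | u ∈ distributions n V E Ω ∧ ∀ (φ : testSections n (W →L[ℝ] ℝ) (DualBundle F) Ω)
    (ψ : testSections n (V →L[ℝ] ℝ) (DualBundle E) Ω),
      IsFormalDual μ L (φ : SmoothSection (n := n) (W →L[ℝ] ℝ) (DualBundle F)) ψ → u ψ = 0}
  zero_mem' := ⟨Submodule.zero_mem _, fun _ _ _ => rfl⟩
  add_mem' := fun {u v} hu hv => ⟨Submodule.add_mem _ hu.1 hv.1, fun φ ψ h => by
    simp [hu.2 φ ψ h, hv.2 φ ψ h]⟩
  smul_mem' := fun c u hu => ⟨Submodule.smul_mem _ c hu.1, fun φ ψ h => by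
    simp [hu.2 φ ψ h]⟩

/-- `L` is weakly hypoelliptic: over every open `Ω ⊆ M`, every distributional solution of `L u = 0`
is smooth. -/
def WeaklyHypoelliptic (L : SmoothSection (n := n) V E →ₗ[ℝ] SmoothSection (n := n) W F) : Prop :=
  ∀ (Ω : TopologicalSpace.Opens M), ∀ u ∈ solutionSpace μ L Ω, IsSmoothDistribution μ u

end WeakSolutions

end WeakHypo

end

set_option linter.unusedSectionVars false

/-! By weak hypoellipticity every distributional solution on `M` comes from a smooth section. Cover
the compact manifold by finitely many charts and trivializations, and read smooth sections as tuples
of continuous functions on closed balls `B i`. This embeds the smooth solutions in the Banach space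
`∀ i, C(B i, V)`.

The image is closed (`isClosed_map_localRestriction`). A uniform limit of solutions is a continuous
section. It still solves `L u = 0` weakly, because in the weak equation the operator acts only on
the test section. Hypoellipticity then makes the limit smooth.

Every element of the image is Lipschitz, being smooth on compact convex balls. A closed space of
Lipschitz functions on compact metric spaces is finite-dimensional
(`Submodule.finiteDimensional_of_isClosed_of_lipschitz`): Banach–Steinhaus makes the Lipschitz
constants uniform on the unit ball, Arzelà–Ascoli makes that ball compact, and Riesz's theorem
concludes. -/

/-! ### Functional analysis: closed spaces of Lipschitz functions. -/

theorem Submodule.finiteDimensional_of_isClosed_of_lipschitz {ι V : Type*} [Finite ι]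
    {K : ι → Type*} [∀ i, MetricSpace (K i)] [∀ i, CompactSpace (K i)]
    [NormedAddCommGroup V] [NormedSpace ℝ V] [FiniteDimensional ℝ V]
    (Y : Submodule ℝ (∀ i, C(K i, V))) (hY : IsClosed (Y : Set (∀ i, C(K i, V))))
    (hlip : ∀ f ∈ Y, ∀ i, ∃ C, LipschitzWith C (f i)) : FiniteDimensional ℝ Y := by
  cases nonempty_fintype ι
  have : CompleteSpace Y := hY.completeSpace_coe
  have key (i : ι) : ∃ C : ℝ, ∀ f : Y, ∀ x y, ‖f.1 i x - f.1 i y‖ ≤ C * ‖f‖ * dist x y := by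
    -- Difference quotients, as bounded operators on the Banach space `Y`. The Lipschitz hypothesis
    -- bounds them pointwise in `f`. On the diagonal `0⁻¹ = 0` gives the zero operator, so no pairs
    -- need to be excluded.
    let g (q : K i × K i) : Y →L[ℝ] V := (dist q.1 q.2)⁻¹ •
      (ContinuousMap.evalCLM ℝ q.1 - ContinuousMap.evalCLM ℝ q.2) ∘L
        (ContinuousLinearMap.proj (R := ℝ) (φ := fun i => C(K i, V)) i) ∘L Y.subtypeL
    have hg (q f) : g q f = (dist q.1 q.2)⁻¹ • (f.1 i q.1 - f.1 i q.2) := rfl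
    obtain ⟨C, hC⟩ := banach_steinhaus (g := g) fun f => by
      obtain ⟨C, hC⟩ := hlip f.1 f.2 i
      refine ⟨C, fun q => ?_⟩
      rw [hg, norm_smul, norm_inv, Real.norm_of_nonneg dist_nonneg]
      exact inv_mul_le_of_le_mul₀ dist_nonneg C.2
        (by rw [mul_comm, ← dist_eq_norm]; exact hC.dist_le_mul _ _)
    refine ⟨C, fun f x y => ?_⟩
    rcases eq_or_ne x y with rfl | hxy
    · simp
    have h := (g (x, y)).le_of_opNorm_le (hC (x, y)) f
    rw [hg, norm_smul, norm_inv, Real.norm_of_nonneg dist_nonneg] at h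
    rwa [inv_mul_le_iff₀ (dist_pos.2 hxy), mul_comm] at h
  choose C hC using key
  -- The absolute value is needed because the constant `C i` is not known to be nonnegative.
  let A (i : ι) : Set C(K i, V) :=
    {f | (∀ x, f x ∈ Metric.closedBall 0 1) ∧ ∀ x y, ‖f x - f y‖ ≤ |C i| * dist x y}
  have hA (i : ι) : IsCompact (A i) := by
    let e := ContinuousMap.isometryEquivBoundedOfCompact (K i) V
    have hcl : IsClosed (e.symm ⁻¹' A i) := by
      refine IsClosed.preimage e.symm.continuous ?_
      simp only [A, ofPred_and, ofPred_forall]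
      refine (isClosed_iInter fun x => Metric.isClosed_closedBall.preimage (by fun_prop)).inter
        (isClosed_iInter fun x => isClosed_iInter fun y => isClosed_le ?_ continuous_const)
      fun_prop
    rw [← e.symm.toHomeomorph.isCompact_preimage]
    refine BoundedContinuousFunction.arzela_ascoli₂ (Metric.closedBall 0 1)
      (isCompact_closedBall _ _) _ hcl (fun f x hf => hf.1 x) ?_
    refine (LipschitzWith.uniformEquicontinuous _ (Real.nnabs (C i))
      fun f => LipschitzWith.of_dist_le_mul fun x y => ?_).equicontinuous
    rw [dist_eq_norm]
    exact f.2.2 x y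
  refine FiniteDimensional.of_isCompact_closedBall₀ ℝ one_pos ?_
  have : IsCompact ((Y : Set (∀ i, C(K i, V))) ∩ univ.pi A) :=
    (isCompact_univ_pi hA).inter_left hY
  rw [Subtype.isCompact_iff]
  -- The unit ball of `Y` is closed in the product and lies in the compact set just found.
  refine this.of_isClosed_subset (hY.isClosedEmbedding_subtypeVal.isClosedMap _
    Metric.isClosed_closedBall) ?_
  rintro _ ⟨f, hf, rfl⟩
  rw [mem_closedBall_zero_iff] at hf
  refine ⟨f.2, fun i _ => ⟨fun x => ?_, fun x y => ?_⟩⟩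
  · rw [mem_closedBall_zero_iff]
    exact ((f.1 i).norm_coe_le_norm x).trans ((norm_le_pi_norm f.1 i).trans hf)
  · refine (hC i f x y).trans (mul_le_mul_of_nonneg_right ?_ dist_nonneg)
    exact (mul_le_mul (le_abs_self _) hf (norm_nonneg _) (abs_nonneg _)).trans_eq (mul_one _)

noncomputable section

namespace WeakHypo

/-! ### Smooth positive densities: local finiteness and positivity on open sets. -/

section Density

variable {n : ℕ} {M : Type*} [TopologicalSpace M] [ChartedSpace (EuclideanSpace ℝ (Fin n)) M]
  [MeasurableSpace M] [BorelSpace M] {μ : Measure M}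

theorem IsSmoothPositiveDensity.measure_preimage (hμ : IsSmoothPositiveDensity (n := n) μ)
    {e : OpenPartialHomeomorph M (EuclideanSpace ℝ (Fin n))}
    (he : e ∈ atlas (EuclideanSpace ℝ (Fin n)) M) :
    ∃ ρ : EuclideanSpace ℝ (Fin n) → ℝ, ContinuousOn ρ e.target ∧ (∀ y ∈ e.target, 0 < ρ y) ∧
      ∀ s ⊆ e.target, MeasurableSet s →
        μ (e.source ∩ e ⁻¹' s) = ∫⁻ y in s, ENNReal.ofReal (ρ y) := by
  obtain ⟨ρ, hρ, hpos, h⟩ := hμ e he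
  refine ⟨ρ, hρ.continuousOn, hpos, fun s hs hms => ?_⟩
  have hae : AEMeasurable e (μ.restrict e.source) :=
    e.continuousOn.aemeasurable e.open_source.measurableSet
  have := congrArg (fun ν : Measure _ => ν s) h
  simp only [Measure.map_apply_of_aemeasurable hae hms, withDensity_apply _ hms,
    Measure.restrict_restrict hms, inter_eq_left.2 hs] at this
  rw [← this, Measure.restrict_apply₀' e.open_source.measurableSet.nullMeasurableSet, inter_comm]

theorem IsSmoothPositiveDensity.isLocallyFiniteMeasure
    (hμ : IsSmoothPositiveDensity (n := n) μ) : IsLocallyFiniteMeasure μ := by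
  refine ⟨fun p => ?_⟩
  set e := chartAt (EuclideanSpace ℝ (Fin n)) p
  obtain ⟨ρ, hρ, -, h⟩ := hμ.measure_preimage (chart_mem_atlas _ p)
  have hp : p ∈ e.source := mem_chart_source _ p
  obtain ⟨r, hr, hsub⟩ := Metric.nhds_basis_closedBall.mem_iff.1
    (e.open_target.mem_nhds (e.map_source hp))
  refine ⟨e.source ∩ e ⁻¹' Metric.closedBall (e p) r, ?_, ?_⟩
  · exact inter_mem (e.open_source.mem_nhds hp)
      ((e.continuousAt hp).preimage_mem_nhds (Metric.closedBall_mem_nhds _ hr))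
  · rw [h _ hsub Metric.isClosed_closedBall.measurableSet]
    exact ((hρ.mono hsub).integrableOn_compact (isCompact_closedBall _ _)).lintegral_lt_top

theorem IsSmoothPositiveDensity.isOpenPosMeasure
    (hμ : IsSmoothPositiveDensity (n := n) μ) : μ.IsOpenPosMeasure := by
  refine ⟨fun U hU ⟨p, hpU⟩ h0 => ?_⟩
  set e := chartAt (EuclideanSpace ℝ (Fin n)) p
  obtain ⟨ρ, hρ, hpos, h⟩ := hμ.measure_preimage (chart_mem_atlas _ p)
  have hp : p ∈ e.source := mem_chart_source _ p
  have hO : IsOpen (e.target ∩ e.symm ⁻¹' U) := e.isOpen_inter_preimage_symm hU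
  have hne : (e.target ∩ e.symm ⁻¹' U).Nonempty :=
    ⟨e p, e.map_source hp, by simpa [e.left_inv hp] using hpU⟩
  have h1 := h _ inter_subset_left hO.measurableSet
  have hsub : e.source ∩ e ⁻¹' (e.target ∩ e.symm ⁻¹' U) ⊆ U := fun x ⟨hx, _, hxU⟩ => by
    rwa [mem_preimage, e.left_inv hx] at hxU
  rw [measure_mono_null hsub h0, eq_comm, lintegral_eq_zero_iff'
    ((hρ.mono inter_subset_left).aemeasurable hO.measurableSet).ennreal_ofReal] at h1
  -- The density vanishes almost everywhere on this open set but is strictly positive at each of its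
  -- points, so the set would be Lebesgue-null.
  have h2 : ∀ᵐ y ∂volume.restrict (e.target ∩ e.symm ⁻¹' U), False := by
    filter_upwards [h1, ae_restrict_mem hO.measurableSet] with y hy hyO
    exact (ENNReal.ofReal_pos.2 (hpos y hyO.1)).ne' hy
  rw [ae_iff] at h2
  simp only [not_false_eq_true, ofPred_true, Measure.restrict_apply_univ] at h2
  exact hO.measure_ne_zero volume hne h2

end Density

/-! ### Sections and the dual pairing in local coordinates. -/

section LocalRep

variable {n : ℕ} {M : Type*} [TopologicalSpace M] [ChartedSpace (EuclideanSpace ℝ (Fin n)) M]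
  {V : Type*} [NormedAddCommGroup V] [NormedSpace ℝ V]
  {E : M → Type*} [∀ x, AddCommGroup (E x)] [∀ x, Module ℝ (E x)] [∀ x, TopologicalSpace (E x)]
  [TopologicalSpace (TotalSpace V E)] [FiberBundle V E] [VectorBundle ℝ V E]

variable (n V E) in
/-- The image of `localDomain n V E p` under the chart around `p`. -/
def localTarget (p : M) : Set (EuclideanSpace ℝ (Fin n)) :=
  (chartAt (EuclideanSpace ℝ (Fin n)) p).target ∩
    (chartAt (EuclideanSpace ℝ (Fin n)) p).symm ⁻¹' (trivializationAt V E p).baseSet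

theorem isOpen_localTarget (p : M) : IsOpen (localTarget n V E p) :=
  (chartAt (EuclideanSpace ℝ (Fin n)) p).isOpen_inter_preimage_symm
    (trivializationAt V E p).open_baseSet

theorem mapsTo_symm_localTarget (p : M) :
    MapsTo (chartAt (EuclideanSpace ℝ (Fin n)) p).symm (localTarget n V E p)
      (localDomain n V E p) :=
  fun _ hy => ⟨(chartAt _ p).map_target hy.1, hy.2⟩

theorem mem_localTarget_self (p : M) :
    chartAt (EuclideanSpace ℝ (Fin n)) p p ∈ localTarget n V E p := by
  refine ⟨mem_chart_target _ p, ?_⟩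
  rw [mem_preimage, (chartAt _ p).left_inv (mem_chart_source _ p)]
  exact FiberBundle.mem_baseSet_trivializationAt' p

theorem localRep_chartAt {p x : M} (hx : x ∈ (chartAt (EuclideanSpace ℝ (Fin n)) p).source)
    (s : Π x, E x) :
    localRep V p s (chartAt (EuclideanSpace ℝ (Fin n)) p x) =
      (trivializationAt V E p (TotalSpace.mk' V x (s x))).2 := by
  rw [localRep, (chartAt _ p).left_inv hx]

theorem localRep_add {p : M} {y : EuclideanSpace ℝ (Fin n)} (hy : y ∈ localTarget n V E p)
    (s t : Π x, E x) : localRep V p (s + t) y = localRep V p s y + localRep V p t y :=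
  ((trivializationAt V E p).linear ℝ hy.2).map_add _ _

theorem localRep_smul {p : M} {y : EuclideanSpace ℝ (Fin n)} (hy : y ∈ localTarget n V E p)
    (c : ℝ) (s : Π x, E x) : localRep V p (c • s) y = c • localRep V p s y :=
  ((trivializationAt V E p).linear ℝ hy.2).map_smul _ _

theorem continuousOn_localRep {s : Π x, E x} (hs : Continuous fun x => TotalSpace.mk' V x (s x))
    (p : M) : ContinuousOn (localRep (n := n) V p s) (localTarget n V E p) := by
  refine continuous_snd.comp_continuousOn ((trivializationAt V E p).continuousOn.comp
    (hs.comp_continuousOn ((chartAt _ p).continuousOn_symm.mono inter_subset_left)) ?_)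
  exact fun y hy => (trivializationAt V E p).mem_source.2 hy.2

theorem contDiffOn_localRep [IsManifold (𝓡 n) ∞ M] [ContMDiffVectorBundle ∞ V E (𝓡 n)]
    (s : SmoothSection (n := n) V E) (p : M) :
    ContDiffOn ℝ ∞ (localRep V p s) (localTarget n V E p) := by
  rw [← contMDiffOn_iff_contDiffOn]
  have h := ((trivializationAt V E p).contMDiffOn_section_baseSet_iff (IB := 𝓡 n) (n := ∞)).1
    s.contMDiff.contMDiffOn
  exact h.comp ((contMDiffOn_chart_symm (I := 𝓡 n) (x := p)).mono inter_subset_left)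
    fun y hy => hy.2

theorem eq_of_localRep_eq {p x : M} (hx : x ∈ localDomain n V E p) {s t : Π x, E x}
    (h : localRep V p s (chartAt (EuclideanSpace ℝ (Fin n)) p x) =
      localRep V p t (chartAt (EuclideanSpace ℝ (Fin n)) p x)) : s x = t x := by
  rw [localRep_chartAt hx.1, localRep_chartAt hx.1] at h
  exact ((trivializationAt V E p).continuousLinearEquivAt ℝ x hx.2).injective h

/-- The trivialization induced on the dual bundle precomposes with the inverse of that of `E`, so
the two coordinate changes cancel in the pairing. -/
theorem apply_eq_localRep {p x : M} (hx : x ∈ localDomain n V E p) (φ : Π x, DualBundle E x)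
    (s : Π x, E x) :
    φ x (s x) = localRep (V →L[ℝ] ℝ) p φ (chartAt (EuclideanSpace ℝ (Fin n)) p x)
      (localRep V p s (chartAt (EuclideanSpace ℝ (Fin n)) p x)) := by
  rw [localRep_chartAt hx.1, localRep_chartAt hx.1]
  have h := hom_trivializationAt_apply (σ := RingHom.id ℝ) (F₁ := V) (E₁ := E) (F₂ := ℝ)
    (E₂ := Bundle.Trivial M ℝ) p
    (TotalSpace.mk' (V →L[ℝ] ℝ) x (φ x))
  rw [h, ContinuousLinearMap.inCoordinates_eq hx.2 (mem_univ x)]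
  change φ x (s x) = φ x (((trivializationAt V E p).continuousLinearEquivAt ℝ x hx.2).symm
    ((trivializationAt V E p).continuousLinearEquivAt ℝ x hx.2 (s x)))
  rw [ContinuousLinearEquiv.symm_apply_apply]

theorem norm_apply_le {p x : M} (hx : x ∈ localDomain n V E p) (φ : Π x, DualBundle E x)
    (s : Π x, E x) :
    ‖φ x (s x)‖ ≤ ‖localRep (V →L[ℝ] ℝ) p φ (chartAt (EuclideanSpace ℝ (Fin n)) p x)‖ *
      ‖localRep V p s (chartAt (EuclideanSpace ℝ (Fin n)) p x)‖ := by
  rw [apply_eq_localRep hx]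
  exact ContinuousLinearMap.le_opNorm _ _

/-- The base set of the hom bundle trivialization is that of `E` intersected with that of the
trivial line bundle, which is everything. -/
theorem localTarget_dual (p : M) :
    localTarget n (V →L[ℝ] ℝ) (DualBundle E) p = localTarget n V E p := by
  simp only [localTarget]
  congr 2
  exact inter_univ _

theorem localDomain_dual (p : M) :
    localDomain n (V →L[ℝ] ℝ) (DualBundle E) p = localDomain n V E p := by
  simp only [localDomain]
  congr 1
  exact inter_univ _

theorem continuousAt_of_continuousAt_localRep {s : Π x, E x} {p x : M}
    (hx : x ∈ localDomain n V E p)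
    (h : ContinuousAt (localRep V p s) (chartAt (EuclideanSpace ℝ (Fin n)) p x)) :
    ContinuousAt (fun x => TotalSpace.mk' V x (s x)) x := by
  have hb := (trivializationAt V E p).open_baseSet.mem_nhds hx.2
  have hc := (chartAt (EuclideanSpace ℝ (Fin n)) p).open_source.mem_nhds hx.1
  rw [(trivializationAt V E p).toOpenPartialHomeomorph.continuousAt_iff_continuousAt_comp_left
    (by filter_upwards [hb] with y hy using (trivializationAt V E p).mem_source.2 hy)]
  have h2 := continuousAt_id.prodMk (h.comp ((chartAt _ p).continuousAt hx.1))
  refine h2.congr ?_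
  filter_upwards [hb, hc] with y hy hy'
  refine Prod.ext (Trivialization.coe_fst' (e := trivializationAt V E p) (x := ⟨y, s y⟩) hy).symm ?_
  exact localRep_chartAt hy' s

theorem continuous_pairing {φ : Π x, DualBundle E x} {s : Π x, E x}
    (hφ : Continuous fun x => TotalSpace.mk' (V →L[ℝ] ℝ) x (φ x))
    (hs : Continuous fun x => TotalSpace.mk' V x (s x)) : Continuous fun x => φ x (s x) := by
  have h := Continuous.clm_bundle_apply (F₂ := ℝ) (E₂ := Bundle.Trivial M ℝ) hφ hs
  exact (Bundle.Trivial.homeomorphProd M ℝ).continuous.snd.comp h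

end LocalRep

/-! ### Fundamental lemma of the calculus of variations. -/

section FundamentalLemma

variable {n : ℕ} {M : Type*} [TopologicalSpace M] [T2Space M] [CompactSpace M]
  [ChartedSpace (EuclideanSpace ℝ (Fin n)) M] [IsManifold (𝓡 n) ∞ M]
  [MeasurableSpace M] [BorelSpace M] {μ : Measure M} [IsFiniteMeasure μ] [μ.IsOpenPosMeasure]
  {V : Type*} [NormedAddCommGroup V] [NormedSpace ℝ V]
  {E : M → Type*} [∀ x, AddCommGroup (E x)] [∀ x, Module ℝ (E x)] [∀ x, TopologicalSpace (E x)]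
  [TopologicalSpace (TotalSpace V E)] [FiberBundle V E] [VectorBundle ℝ V E]
  [ContMDiffVectorBundle ∞ V E (𝓡 n)]

/-- If the sections differ at `p`, a covector at `p` separates them. Extended locally and cut off by
a bump function, it gives a test section whose pairing with `s - t` is nonnegative and positive at
`p`. -/
theorem eq_of_forall_integral_eq {s t : Π x, E x}
    (hs : Continuous fun x => TotalSpace.mk' V x (s x))
    (ht : Continuous fun x => TotalSpace.mk' V x (t x))
    (h : ∀ φ : SmoothSection (n := n) (V →L[ℝ] ℝ) (DualBundle E),
      ∫ x, φ x (s x) ∂μ = ∫ x, φ x (t x) ∂μ) : s = t := by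
  funext p
  by_contra hne
  obtain ⟨l, hl⟩ : ∃ l : DualBundle E p, 0 < l (s p - t p) := by
    let e := (trivializationAt V E p).continuousLinearEquivAt ℝ p
      (FiberBundle.mem_baseSet_trivializationAt' p)
    have hv : e (s p - t p) ≠ 0 := by simpa [sub_eq_zero] using hne
    obtain ⟨g, -, hg⟩ := exists_dual_vector ℝ _ (norm_ne_zero_iff.2 hv)
    refine ⟨g.comp (e : E p →L[ℝ] V), ?_⟩
    change 0 < g (e (s p - t p))
    rw [hg]
    exact norm_pos_iff.2 hv
  obtain ⟨u, hu, hsm⟩ := FiberBundle.exists_contMDiffOn_extend (k := ∞) (𝓡 n) (V →L[ℝ] ℝ) l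
  set φ₀ : Π x, DualBundle E x := FiberBundle.extend (V →L[ℝ] ℝ) l
  have hφp : φ₀ p = l := by simp [φ₀]
  have hpair (r : Π x, E x) (hr : Continuous fun x => TotalSpace.mk' V x (r x)) :
      ContinuousOn (fun x => φ₀ x (r x)) u := by
    have h := ContinuousOn.clm_bundle_apply (F₂ := ℝ) (E₂ := Bundle.Trivial M ℝ)
      hsm.continuousOn hr.continuousOn
    exact (Bundle.Trivial.homeomorphProd M ℝ).continuous.snd.comp_continuousOn h
  have hcont := (hpair s hs).sub (hpair t ht)
  have hnhds : {x | 0 < φ₀ x (s x) - φ₀ x (t x)} ∈ 𝓝 p :=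
    (hcont.continuousAt hu).eventually (lt_mem_nhds (by simpa [hφp] using hl))
  -- Only the existence of a bump function is wanted, hence `univ_mem`; `hf` keeps its closed
  -- support where the covector extension is smooth and the pairing difference is positive.
  obtain ⟨f, hf, -⟩ := (SmoothBumpFunction.nhds_basis_support (I := 𝓡 n)
    (interior_mem_nhds.2 (inter_mem hu hnhds))).mem_iff.1 univ_mem
  let φ : SmoothSection (n := n) (V →L[ℝ] ℝ) (DualBundle E) :=
    ⟨⇑f • φ₀, f.contMDiff.contMDiffOn.smul_section_of_tsupport isOpen_interior hf
      (hsm.mono (interior_subset.trans inter_subset_left))⟩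
  have hφ (x) (v) : φ x v = f x * φ₀ x v := rfl
  have hc (r : Π x, E x) (hr : Continuous fun x => TotalSpace.mk' V x (r x)) :=
    continuous_pairing φ.contMDiff.continuous hr
  have hint (r : Π x, E x) (hr : Continuous fun x => TotalSpace.mk' V x (r x)) :
      Integrable (fun x => φ x (r x)) μ :=
    (hc r hr).integrable_of_hasCompactSupport (HasCompactSupport.of_compactSpace _)
  have hpos := ((hc s hs).sub (hc t ht)).integral_pos_of_hasCompactSupport_nonneg_nonzero (μ := μ)
    (x := p) (HasCompactSupport.of_compactSpace _) (fun x => ?_) ?_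
  · rw [Pi.sub_def, integral_sub (hint s hs) (hint t ht), h φ, sub_self] at hpos
    exact hpos.false
  · simp only [Pi.zero_apply, Pi.sub_apply, hφ, ← mul_sub]
    by_cases hx : x ∈ tsupport f
    · exact mul_nonneg f.nonneg (le_of_lt (interior_subset (hf hx)).2)
    · simp [image_eq_zero_of_notMem_tsupport hx]
  · simp only [Pi.sub_apply, hφ, f.eq_one, one_mul]
    exact (mem_of_mem_nhds hnhds).ne'

end FundamentalLemma

/-! ### Embedding into a product of spaces of continuous functions, and limits of pairings. -/

section LocalRestriction

variable {n : ℕ} {M : Type*} [TopologicalSpace M]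
  [ChartedSpace (EuclideanSpace ℝ (Fin n)) M]
  {V : Type*} [NormedAddCommGroup V] [NormedSpace ℝ V]
  {E : M → Type*} [∀ x, AddCommGroup (E x)] [∀ x, Module ℝ (E x)] [∀ x, TopologicalSpace (E x)]
  [TopologicalSpace (TotalSpace V E)] [FiberBundle V E] [VectorBundle ℝ V E]

/-- The local representatives of a smooth section, restricted to a family of subsets of the
images of local domains. -/
def localRestriction {ι : Type*} {p : ι → M} {B : ι → Set (EuclideanSpace ℝ (Fin n))}
    (hB : ∀ i, B i ⊆ localTarget n V E (p i)) :
    SmoothSection (n := n) V E →ₗ[ℝ] ∀ i, C(B i, V) where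
  toFun s i := ⟨(B i).domRestrict (localRep V (p i) s),
    ((continuousOn_localRep s.contMDiff.continuous (p i)).mono (hB i)).domRestrict⟩
  map_add' s t := by
    ext i y
    exact localRep_add (hB i y.2) _ _
  map_smul' c s := by
    ext i y
    exact localRep_smul (hB i y.2) _ _

variable {ι : Type*} {p : ι → M} {B : ι → Set (EuclideanSpace ℝ (Fin n))}
  (hB : ∀ i, B i ⊆ localTarget n V E (p i))
  (hcov : ∀ x, ∃ i, x ∈ (chartAt (EuclideanSpace ℝ (Fin n)) (p i)).source ∧
    chartAt (EuclideanSpace ℝ (Fin n)) (p i) x ∈ interior (B i))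

theorem localRestriction_apply (s : SmoothSection (n := n) V E) (i : ι) (y : B i) :
    localRestriction hB s i y = localRep V (p i) s (y : EuclideanSpace ℝ (Fin n)) := rfl

include hB in
theorem mem_localDomain_of_mem {i : ι} {x : M}
    (hx : x ∈ (chartAt (EuclideanSpace ℝ (Fin n)) (p i)).source)
    (hxB : chartAt (EuclideanSpace ℝ (Fin n)) (p i) x ∈ B i) : x ∈ localDomain n V E (p i) := by
  have := mapsTo_symm_localTarget (V := V) (E := E) (p i) (hB i hxB)
  rwa [(chartAt _ (p i)).left_inv hx] at this

include hcov in
theorem localRestriction_injective : Function.Injective (localRestriction hB) := by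
  refine fun s t h => ContMDiffSection.ext fun x => ?_
  obtain ⟨i, hx, hxB⟩ := hcov x
  exact eq_of_localRep_eq (mem_localDomain_of_mem hB hx (interior_subset hxB))
    (DFunLike.congr_fun (congrFun h i) ⟨_, interior_subset hxB⟩)

include hcov in
-- The limit is taken in each fibre, using one chosen chart per point. Uniqueness of limits shows
-- that every other chart sees the same section, so the local limits glue, and continuity is
-- inherited from the `g i`.
theorem exists_continuous_section_of_tendsto [FiniteDimensional ℝ V]
    {s : ℕ → SmoothSection (n := n) V E} {g : ∀ i, C(B i, V)}
    (hg : ∀ i y, Tendsto (fun j => localRestriction hB (s j) i y) atTop (𝓝 (g i y))) :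
    ∃ σ : Π x, E x, Continuous (fun x => TotalSpace.mk' V x (σ x)) ∧
      ∀ i (y : B i), localRep V (p i) σ (y : EuclideanSpace ℝ (Fin n)) = g i y := by
  choose i hx hxB using hcov
  have hdom (x) := mem_localDomain_of_mem hB (hx x) (interior_subset (hxB x))
  let σ (x : M) : E x := ((trivializationAt V E (p (i x))).continuousLinearEquivAt ℝ x
    (hdom x).2).symm (g (i x) ⟨_, interior_subset (hxB x)⟩)
  have hlim (x : M) : Tendsto (fun j => s j x) atTop (𝓝 (σ x)) := by
    have h1 := (((trivializationAt V E (p (i x))).continuousLinearEquivAt ℝ x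
      (hdom x).2).symm.continuous.tendsto _).comp (hg (i x) ⟨_, interior_subset (hxB x)⟩)
    refine h1.congr fun j => ?_
    rw [Function.comp_apply, ContinuousLinearEquiv.symm_apply_eq, localRestriction_apply,
      localRep_chartAt (hx x)]
    rfl
  have hrep (k : ι) (y : B k) : localRep V (p k) σ (y : EuclideanSpace ℝ (Fin n)) = g k y := by
    refine tendsto_nhds_unique ?_ (hg k y)
    let x := (chartAt (EuclideanSpace ℝ (Fin n)) (p k)).symm y
    exact (((trivializationAt V E (p k)).continuousLinearEquivAt ℝ x
      (hB k y.2).2).continuous.tendsto _).comp (hlim x)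
  refine ⟨σ, continuous_iff_continuousAt.2 fun x => ?_, hrep⟩
  refine continuousAt_of_continuousAt_localRep (hdom x) ?_
  have : ContinuousOn (localRep V (p (i x)) σ) (B (i x)) := by
    rw [continuousOn_iff_continuous_domRestrict]
    exact (g (i x)).continuous.congr fun y => (hrep (i x) y).symm
  exact this.continuousAt (mem_interior_iff_mem_nhds.1 (hxB x))

variable [T2Space M] [CompactSpace M] [MeasurableSpace M] [BorelSpace M] {μ : Measure M}
  [IsFiniteMeasure μ]

theorem integrable_pairing {φ : Π x, DualBundle E x} {s : Π x, E x}
    (hφ : Continuous fun x => TotalSpace.mk' (V →L[ℝ] ℝ) x (φ x))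
    (hs : Continuous fun x => TotalSpace.mk' V x (s x)) : Integrable (fun x => φ x (s x)) μ :=
  (continuous_pairing hφ hs).integrable_of_hasCompactSupport (HasCompactSupport.of_compactSpace _)

include hB hcov in
-- Dominated convergence. It serves both for continuity of distributions (test sections vary) and
-- for passing to the limit in the weak equation (solutions vary).
theorem tendsto_integral_pairing [Finite ι] {φ : ℕ → Π x, DualBundle E x} {s : ℕ → Π x, E x}
    {φ' : Π x, DualBundle E x} {s' : Π x, E x}
    (hφ : ∀ j, Continuous fun x => TotalSpace.mk' (V →L[ℝ] ℝ) x (φ j x))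
    (hs : ∀ j, Continuous fun x => TotalSpace.mk' V x (s j x))
    (hφlim : ∀ i, ∀ y ∈ B i, Tendsto (fun j => localRep (V →L[ℝ] ℝ) (p i) (φ j) y) atTop
      (𝓝 (localRep (V →L[ℝ] ℝ) (p i) φ' y)))
    (hslim : ∀ i, ∀ y ∈ B i, Tendsto (fun j => localRep V (p i) (s j) y) atTop
      (𝓝 (localRep V (p i) s' y)))
    (hφb : ∀ i, ∃ C, ∀ᶠ j in atTop, ∀ y ∈ B i, ‖localRep (V →L[ℝ] ℝ) (p i) (φ j) y‖ ≤ C)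
    (hsb : ∀ i, ∃ C, ∀ᶠ j in atTop, ∀ y ∈ B i, ‖localRep V (p i) (s j) y‖ ≤ C) :
    Tendsto (fun j => ∫ x, φ j x (s j x) ∂μ) atTop (𝓝 (∫ x, φ' x (s' x) ∂μ)) := by
  cases nonempty_fintype ι
  choose C hC using hφb
  choose D hD using hsb
  refine tendsto_integral_filter_of_dominated_convergence (fun _ => ∑ i, |C i| * |D i|)
    (Eventually.of_forall fun j => (integrable_pairing (hφ j) (hs j)).aestronglyMeasurable) ?_
    (integrable_const _) (Eventually.of_forall fun x => ?_)
  · filter_upwards [eventually_all.2 hC, eventually_all.2 hD] with j hCj hDj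
    refine Eventually.of_forall fun x => ?_
    obtain ⟨i, hx, hxB⟩ := hcov x
    refine (norm_apply_le (mem_localDomain_of_mem hB hx (interior_subset hxB)) _ _).trans ?_
    refine le_trans ?_ (Finset.single_le_sum (f := fun i => |C i| * |D i|)
      (fun i _ => by positivity) (Finset.mem_univ i))
    exact mul_le_mul ((hCj i _ (interior_subset hxB)).trans (le_abs_self _))
      ((hDj i _ (interior_subset hxB)).trans (le_abs_self _)) (norm_nonneg _) (abs_nonneg _)
  · obtain ⟨i, hx, hxB⟩ := hcov x
    have hdom := mem_localDomain_of_mem hB hx (interior_subset hxB)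
    simp only [apply_eq_localRep hdom]
    exact (isBoundedBilinearMap_apply.continuous.tendsto (_, _)).comp
      ((hφlim i _ (interior_subset hxB)).prodMk_nhds (hslim i _ (interior_subset hxB)))

variable (μ) in
/-- The functional on test sections defined by a continuous section. -/
def sectionFunctional (s : Π x, E x) (hs : Continuous fun x => TotalSpace.mk' V x (s x)) :
    Module.Dual ℝ (testSections n (V →L[ℝ] ℝ) (DualBundle E) ⊤) where
  toFun φ := ∫ x, (φ : SmoothSection (n := n) (V →L[ℝ] ℝ) (DualBundle E)) x (s x) ∂μ
  map_add' φ ψ := integral_add (integrable_pairing φ.1.contMDiff.continuous hs)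
    (integrable_pairing ψ.1.contMDiff.continuous hs)
  map_smul' c _ := integral_const_mul c _

include hB hcov in
theorem sectionFunctional_mem_distributions [Finite ι] (hBc : ∀ i, IsCompact (B i))
    {s : Π x, E x} (hs : Continuous fun x => TotalSpace.mk' V x (s x)) :
    sectionFunctional μ s hs ∈ distributions n V E ⊤ := by
  intro φ hφ
  have hzero : (0 : ℝ) = ∫ x, (0 : Π x, DualBundle E x) x (s x) ∂μ := by simp
  -- Only derivatives of order `0` matter, since a continuous section defines a distribution of
  -- order zero.
  have hunif (i : ι) : TendstoUniformlyOn
      (fun j => localRep (n := n) (V →L[ℝ] ℝ) (p i) (φ j).1) (fun _ => 0) atTop (B i) := by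
    have h := hφ.2 (p i) ((chartAt (EuclideanSpace ℝ (Fin n)) (p i)).symm '' B i)
      ((hBc i).image_of_continuousOn ((chartAt _ (p i)).continuousOn_symm.mono
        ((hB i).trans inter_subset_left)))
      (by rw [localDomain_dual, image_subset_iff]
          exact fun y hy => mapsTo_symm_localTarget (p i) (hB i hy)) 0
    rw [Metric.tendstoUniformlyOn_iff] at h ⊢
    intro ε hε
    filter_upwards [h ε hε] with j hj y hy
    have h := hj _ (mem_image_of_mem _ hy)
    rwa [(chartAt _ (p i)).right_inv (hB i hy).1, dist_zero_left, norm_iteratedFDeriv_zero,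
      ← dist_zero_left] at h
  rw [hzero]
  have hrep0 (i : ι) (y) (hy : y ∈ B i) :
      localRep (V →L[ℝ] ℝ) (p i) (0 : Π x, DualBundle E x) y = 0 := by
    simpa using localRep_smul ((localTarget_dual (p i)).ge (hB i hy)) 0 (0 : Π x, DualBundle E x)
  refine tendsto_integral_pairing (s := fun _ => s) hB hcov
    (fun j => (φ j).1.contMDiff.continuous) (fun _ => hs) (fun i y hy => ?_)
    (fun i y hy => tendsto_const_nhds) (fun i => ⟨1, ?_⟩) (fun i => ?_)
  · rw [hrep0 i y hy]
    exact (hunif i).tendsto_at hy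
  · filter_upwards [Metric.tendstoUniformlyOn_iff.1 (hunif i) 1 one_pos] with j hj y hy
    simpa using (hj y hy).le
  · obtain ⟨C, hC⟩ := (hBc i).exists_bound_of_continuousOn
      ((continuousOn_localRep hs (p i)).mono (hB i))
    exact ⟨C, Eventually.of_forall fun _ => hC⟩

variable (μ) in
/-- The distribution defined by a smooth section, as a linear map. -/
def smoothToDual : SmoothSection (n := n) V E →ₗ[ℝ]
    Module.Dual ℝ (testSections n (V →L[ℝ] ℝ) (DualBundle E) ⊤) where
  toFun s := sectionFunctional μ s s.contMDiff.continuous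
  map_add' s t := by
    ext φ
    refine Eq.trans ?_ (integral_add
      (integrable_pairing φ.1.contMDiff.continuous s.contMDiff.continuous)
      (integrable_pairing φ.1.contMDiff.continuous t.contMDiff.continuous))
    exact integral_congr_ae (Eventually.of_forall fun x => (φ.1 x).map_add _ _)
  map_smul' c s := by
    ext φ
    refine Eq.trans ?_ (integral_const_mul c _)
    exact integral_congr_ae (Eventually.of_forall fun x => (φ.1 x).map_smul _ _)

end LocalRestriction

/-! ### Closedness and finite-dimensionality of the solution space. -/

section Solutions

variable {n : ℕ} {M : Type*} [TopologicalSpace M] [T2Space M] [CompactSpace M]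
  [ChartedSpace (EuclideanSpace ℝ (Fin n)) M] [IsManifold (𝓡 n) ∞ M]
  [MeasurableSpace M] [BorelSpace M] {μ : Measure M} [IsFiniteMeasure μ]
  {V : Type*} [NormedAddCommGroup V] [NormedSpace ℝ V]
  {E : M → Type*} [∀ x, AddCommGroup (E x)] [∀ x, Module ℝ (E x)] [∀ x, TopologicalSpace (E x)]
  [TopologicalSpace (TotalSpace V E)] [FiberBundle V E] [VectorBundle ℝ V E]
  [ContMDiffVectorBundle ∞ V E (𝓡 n)]
  {W : Type*} [NormedAddCommGroup W] [NormedSpace ℝ W]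
  {F : M → Type*} [∀ x, AddCommGroup (F x)] [∀ x, Module ℝ (F x)] [∀ x, TopologicalSpace (F x)]
  [TopologicalSpace (TotalSpace W F)] [FiberBundle W F] [VectorBundle ℝ W F]
  {L : SmoothSection (n := n) V E →ₗ[ℝ] SmoothSection (n := n) W F}

theorem WeaklyHypoelliptic.exists_smoothToDual_eq (hL : WeaklyHypoelliptic μ L)
    {u : Module.Dual ℝ (testSections n (V →L[ℝ] ℝ) (DualBundle E) ⊤)}
    (hu : u ∈ solutionSpace μ L ⊤) : ∃ s, smoothToDual μ s = u := by
  obtain ⟨s, hs, h⟩ := hL ⊤ u hu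
  refine ⟨⟨s, contMDiffOn_univ.1 hs⟩, ?_⟩
  ext φ
  rw [h φ, TopologicalSpace.Opens.coe_top, Measure.restrict_univ]
  rfl

theorem mem_testSections_top (φ : SmoothSection (n := n) (V →L[ℝ] ℝ) (DualBundle E)) :
    φ ∈ testSections n (V →L[ℝ] ℝ) (DualBundle E) (⊤ : TopologicalSpace.Opens M) :=
  ⟨isClosed_closure.isCompact, subset_univ _⟩

/-- Hypoellipticity acts here as a regularity gain: the limit is a priori only continuous, yet as a
weak solution it is represented by a smooth section, which the fundamental lemma identifies with the
limit itself. -/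
theorem WeaklyHypoelliptic.isClosed_map_localRestriction [FiniteDimensional ℝ V]
    [μ.IsOpenPosMeasure] (hL : WeaklyHypoelliptic μ L) {ι : Type*} [Finite ι] {p : ι → M}
    {B : ι → Set (EuclideanSpace ℝ (Fin n))} (hB : ∀ i, B i ⊆ localTarget n V E (p i))
    (hcov : ∀ x, ∃ i, x ∈ (chartAt (EuclideanSpace ℝ (Fin n)) (p i)).source ∧
      chartAt (EuclideanSpace ℝ (Fin n)) (p i) x ∈ interior (B i))
    (hBc : ∀ i, IsCompact (B i)) [∀ i, CompactSpace (B i)] :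
    IsClosed ((((solutionSpace μ L ⊤).comap (smoothToDual μ)).map (localRestriction hB) :
      Submodule ℝ (∀ i, C(B i, V))) : Set (∀ i, C(B i, V))) := by
  refine isClosed_of_closure_subset fun g hg => ?_
  obtain ⟨f, hf, hfg⟩ := mem_closure_iff_seq_limit.1 hg
  choose s hs hsf using hf
  obtain rfl : (fun j => localRestriction hB (s j)) = f := funext hsf
  have hi (i : ι) : Tendsto (fun j => localRestriction hB (s j) i) atTop (𝓝 (g i)) :=
    (tendsto_pi_nhds.1 hfg) i
  have hpt (i : ι) (y : B i) :
      Tendsto (fun j => localRestriction hB (s j) i y) atTop (𝓝 (g i y)) :=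
    ((ContinuousEvalConst.continuous_eval_const y).tendsto _).comp (hi i)
  obtain ⟨σ, hσ, hσg⟩ := exists_continuous_section_of_tendsto hB hcov hpt
  have hlim (φ : SmoothSection (n := n) (V →L[ℝ] ℝ) (DualBundle E)) :
      Tendsto (fun j => ∫ x, φ x (s j x) ∂μ) atTop (𝓝 (∫ x, φ x (σ x) ∂μ)) := by
    refine tendsto_integral_pairing (φ := fun _ => φ) (s := fun j => s j) hB hcov
      (fun _ => φ.contMDiff.continuous)
      (fun j => (s j).contMDiff.continuous) (fun _ _ _ => tendsto_const_nhds)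
      (fun i y hy => ?_) (fun i => ?_) (fun i => ?_)
    · rw [hσg i ⟨y, hy⟩]
      exact hpt i ⟨y, hy⟩
    · obtain ⟨C, hC⟩ := (hBc i).exists_bound_of_continuousOn
        ((continuousOn_localRep φ.contMDiff.continuous (p i)).mono
          ((hB i).trans (localTarget_dual _).ge))
      exact ⟨C, Eventually.of_forall fun _ => hC⟩
    · refine ⟨‖g i‖ + 1, ?_⟩
      filter_upwards [(hi i).norm.eventually (Iio_mem_nhds (lt_add_one _))] with j hj y hy
      exact ((localRestriction hB (s j) i).norm_coe_le_norm ⟨y, hy⟩).trans hj.le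
  have hsol : sectionFunctional μ σ hσ ∈ solutionSpace μ L ⊤ := by
    refine ⟨sectionFunctional_mem_distributions hB hcov hBc hσ, fun φ ψ h => ?_⟩
    refine tendsto_nhds_unique (hlim ψ) ?_
    -- Each integral against `ψ` is zero because `s j` is a solution, so the limit is zero too.
    exact tendsto_const_nhds.congr fun j => ((hs j).2 φ ψ h).symm
  obtain ⟨τ, hτ⟩ := hL.exists_smoothToDual_eq hsol
  have hτσ : ⇑τ = σ := eq_of_forall_integral_eq (μ := μ) τ.contMDiff.continuous hσ
    fun φ => LinearMap.congr_fun hτ ⟨φ, mem_testSections_top φ⟩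
  refine ⟨τ, by rwa [SetLike.mem_coe, Submodule.mem_comap, hτ], ?_⟩
  ext i y
  rw [localRestriction_apply, hτσ, hσg]

variable (n V E) in
theorem exists_finite_cover_localTarget : ∃ (t : Finset M) (r : M → ℝ),
    (∀ p, Metric.closedBall (chartAt (EuclideanSpace ℝ (Fin n)) p p) (r p) ⊆
      localTarget n V E p) ∧
    ∀ x, ∃ p : t, x ∈ (chartAt (EuclideanSpace ℝ (Fin n)) p.1).source ∧
      chartAt (EuclideanSpace ℝ (Fin n)) p.1 x ∈
        interior (Metric.closedBall (chartAt (EuclideanSpace ℝ (Fin n)) p.1 p.1) (r p)) := by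
  have h (p : M) := Metric.nhds_basis_closedBall.mem_iff.1
    ((isOpen_localTarget (n := n) (V := V) (E := E) p).mem_nhds (mem_localTarget_self p))
  choose r hr hsub using h
  obtain ⟨t, ht⟩ := CompactSpace.elim_nhds_subcover (fun p =>
    (chartAt (EuclideanSpace ℝ (Fin n)) p).source ∩ chartAt (EuclideanSpace ℝ (Fin n)) p ⁻¹'
      interior (Metric.closedBall (chartAt (EuclideanSpace ℝ (Fin n)) p p) (r p)))
    fun p => inter_mem ((chartAt _ p).open_source.mem_nhds (mem_chart_source _ p))
      (((chartAt _ p).continuousAt (mem_chart_source _ p)).preimage_mem_nhds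
        (interior_mem_nhds.2 (Metric.closedBall_mem_nhds _ (hr p))))
  refine ⟨t, r, hsub, fun x => ?_⟩
  have hx : x ∈ (⊤ : Set M) := mem_univ x
  rw [← ht, mem_iUnion₂] at hx
  obtain ⟨p, hp, hx⟩ := hx
  exact ⟨⟨p, hp⟩, hx⟩

theorem WeaklyHypoelliptic.finiteDimensional_solutionSpace [FiniteDimensional ℝ V]
    [μ.IsOpenPosMeasure] (hL : WeaklyHypoelliptic μ L) :
    FiniteDimensional ℝ (solutionSpace μ L ⊤) := by
  obtain ⟨t, r, hsub, hcov⟩ := exists_finite_cover_localTarget n V E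
  let B (p : t) := Metric.closedBall (chartAt (EuclideanSpace ℝ (Fin n)) p.1 p.1) (r p)
  have hB (p : t) : B p ⊆ localTarget n V E p.1 := hsub p
  have hBc (p : t) : IsCompact (B p) := isCompact_closedBall _ _
  have (p : t) : CompactSpace (B p) := isCompact_iff_compactSpace.1 (hBc p)
  let S := (solutionSpace μ L ⊤).comap (smoothToDual μ)
  have hfin : FiniteDimensional ℝ (S.map (localRestriction hB)) := by
    refine Submodule.finiteDimensional_of_isClosed_of_lipschitz _
      (hL.isClosed_map_localRestriction hB hcov hBc) ?_
    rintro _ ⟨s, -, rfl⟩ p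
    -- Closed balls were chosen for convexity: the mean value inequality then yields a Lipschitz
    -- bound on a compact set.
    obtain ⟨C, hC⟩ := ((contDiffOn_localRep s p.1).mono (hB p)).exists_lipschitzOnWith
      (by simp) (convex_closedBall _ _) (hBc p)
    exact ⟨C, fun x y => hC x.2 y.2⟩
  have hS : FiniteDimensional ℝ S :=
    (S.equivMapOfInjective _ (localRestriction_injective hB hcov)).symm.finiteDimensional
  -- By hypoellipticity, every distributional solution is the image of a smooth one in `S`.
  refine Submodule.finiteDimensional_of_le (S₂ := S.map (smoothToDual μ)) fun u hu => ?_
  obtain ⟨s, rfl⟩ := hL.exists_smoothToDual_eq hu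
  exact ⟨s, hu, rfl⟩

end Solutions

end WeakHypo

end

theorem corollary2p3 {n : ℕ} {M : Type*} [TopologicalSpace M] [T2Space M] [CompactSpace M]
    [ChartedSpace (EuclideanSpace ℝ (Fin n)) M] [IsManifold (𝓡 n) ∞ M]
    [MeasurableSpace M] [BorelSpace M]
    (μ : Measure M) (hμ : WeakHypo.IsSmoothPositiveDensity (n := n) μ)
    {V : Type*} [NormedAddCommGroup V] [NormedSpace ℝ V] [FiniteDimensional ℝ V]
    {E : M → Type*} [∀ x, AddCommGroup (E x)] [∀ x, Module ℝ (E x)] [∀ x, TopologicalSpace (E x)]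
    [TopologicalSpace (TotalSpace V E)] [FiberBundle V E] [VectorBundle ℝ V E]
    [ContMDiffVectorBundle ∞ V E (𝓡 n)]
    {W : Type*} [NormedAddCommGroup W] [NormedSpace ℝ W] [FiniteDimensional ℝ W]
    {F : M → Type*} [∀ x, AddCommGroup (F x)] [∀ x, Module ℝ (F x)] [∀ x, TopologicalSpace (F x)]
    [TopologicalSpace (TotalSpace W F)] [FiberBundle W F] [VectorBundle ℝ W F]
    [ContMDiffVectorBundle ∞ W F (𝓡 n)]
    (k : ℕ) (L : WeakHypo.SmoothSection (n := n) V E →ₗ[ℝ] WeakHypo.SmoothSection (n := n) W F)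
    (hL : WeakHypo.IsDifferentialOperator k L) (hwh : WeakHypo.WeaklyHypoelliptic μ L) :
    FiniteDimensional ℝ (WeakHypo.solutionSpace μ L ⊤) := by
  have := hμ.isLocallyFiniteMeasure
  have := hμ.isOpenPosMeasure
  exact hwh.finiteDimensional_solutionSpace
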